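/- **Theorem.** Consider an election by the party version of Phragmén's method with two parties $A$ and $B$, where the proportions of ballots naming $A$ only, $B$ only and both parties $AB$ are $\alpha,\beta$ and $\gamma=1-\alpha-\beta$, with $\alpha,\beta\ge 0$, $\alpha+\beta\le 1$ and $\alpha+\beta>0$. The seats are awarded one by one as follows. Each type of ballot $\sigma\in\{A,B,AB\}$, with proportion of votes $v_\sigma$, has a free voting power $x_\sigma$, initially $0$. For each seat, let $\Delta_i$ ($i\in\{A,B\}$) be the solution of $\sum_{\sigma\ni i}v_\sigma(x_\sigma+\Delta_i)=1$ (a party on no ballot has no $\Delta_i$ and is ignored); a party $i$ with minimal $\Delta_i$ gets the seat, ties being broken in an arbitrary way; then $x_\sigma$ is replaced by $0$ if $i\in\sigma$ and by $x_\sigma+\Delta_i$ if $i\notin\sigma$. Parties can be elected any number of times. Let $n_A$ and $n_B$ be the numbers of seats given to $A$ and $B$ when $n$ seats have been awarded. Then there are numbers $p_A$ and $p_B=1-p_A$, depending only on $\alpha$ and $\beta$, such that, however ties are broken, $n_A/n\to p_A$ and $n_B/n\to p_B$ as $n\to\infty$. Furthermore: (i) $n_A=p_An+O(1)$ and $n_B=p_Bn+O(1)$,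 with implied constants depending only on $\alpha$ and $\beta$. (ii) Suppose $\alpha\ge\beta>0$ and let $$a:=\frac{\alpha\beta}{(1-\alpha)(1-\beta)},\qquad b':=\frac{\alpha-\beta}{\beta}+\frac{\alpha(1-\alpha-\beta)}{(1-\alpha)(1-\beta)},\qquad b:=b'-\lfloor b'\rfloor .$$ Then $0<a\le 1$, with $a<1$ if and only if $\gamma>0$, and $$p_B=\frac{1}{2+\lfloor b'\rfloor+\rho},$$ where $\rho$ is the rotation number of the multivalued map $f_\pm(x)=\{f_-(x),f_+(x)\}$ on $[0,1]$; here $f_-(x)$ is the fractional part of $ax+b$ in $[0,1)$, and $f_+(x)$ equals $f_-(x)$ except that it is $1$ when $ax+b$ is an integer. That is, $\rho$ is the number (which exists) such that $F_-^n(x)/n\to\rho$ and $F_+^n(x)/n\to\rho$ as $n\to\infty$ for every $x\in\mathbb R$, where $F_-(x)=ax+b+(1-a)\lfloor x\rfloor$ and $F_+(x)=ax+b-(1-a)\lfloor 1-x\rfloor$ are the lifts of $f_-$ and $f_+$. (iii) If $\alpha\ge\beta>0$, $\rho$ is rational and $\gamma>0$, then, however ties are broken, the sequence of awarded seats is eventually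 periodic. -/

import Mathlib

open Filter Topology

/-! ### The party version of Phragmén's election method -/

namespace Phragmen

/-- The voting power that party `i` can use when every ballot of type `σ` (a set of parties) has
free voting power `x σ`; here `v σ` is the (proportion of) votes for the set `σ`. -/
def power {P : Type*} [Fintype P] [DecidableEq P] (v : Finset P → ℝ) (x : Finset P → ℝ) (i : P) :
    ℝ :=
  ∑ σ : Finset P with i ∈ σ, v σ * x σ

/-- `Requires v x i Δ`: if the voting power of every ballot is increased by `Δ`, starting from the
free voting powers `x`, then party `i` has available voting power exactly `1`.
(If `i` appears on no ballot, there is no such `Δ`, and `i` can never be elected.) -/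
def Requires {P : Type*} [Fintype P] [DecidableEq P] (v : Finset P → ℝ) (x : Finset P → ℝ) (i : P)
    (Δ : ℝ) : Prop :=
  power v (fun σ => x σ + Δ) i = 1

/-- `Step v x i x'`: from the free voting powers `x`, party `i` may be elected to the next seat,
since it requires the smallest increase `Δ` of the voting power (ties may be broken in any way);
the free voting powers after this election are `x'`. Parties can be elected repeatedly. -/
def Step {P : Type*} [Fintype P] [DecidableEq P] (v : Finset P → ℝ) (x : Finset P → ℝ) (i : P)
    (x' : Finset P → ℝ) : Prop :=
  ∃ Δ : ℝ, Requires v x i Δ ∧ (∀ (j : P) (Δ' : ℝ), Requires v x j Δ' → Δ ≤ Δ') ∧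
    x' = fun σ => if i ∈ σ then 0 else x σ + Δ

/-- `s` is a possible infinite sequence of awarded seats (`s n` gets seat number `n + 1`) in the
party version of Phragmén's method with votes `v`, with arbitrary breaking of ties. -/
def IsSeatSequence {P : Type*} [Fintype P] [DecidableEq P] (v : Finset P → ℝ) (s : ℕ → P) : Prop :=
  ∃ x : ℕ → Finset P → ℝ, x 0 = 0 ∧ ∀ n : ℕ, Step v (x n) (s n) (x (n + 1))

/-- The number of seats given to party `i` when the first `n` seats have been distributed. -/
def seats {P : Type*} [DecidableEq P] (s : ℕ → P) (i : P) (n : ℕ) : ℕ :=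
  ((Finset.range n).filter (fun k => s k = i)).card

/-- A sequence is eventually periodic. -/
def EventuallyPeriodic {X : Type*} (s : ℕ → X) : Prop :=
  ∃ N p : ℕ, 0 < p ∧ ∀ n : ℕ, N ≤ n → s (n + p) = s n

/-- The two parties. -/
inductive Party : Type
  | A : Party
  | B : Party

instance : DecidableEq Party
  | .A, .A => isTrue rfl
  | .A, .B => isFalse (fun h => Party.noConfusion h)
  | .B, .A => isFalse (fun h => Party.noConfusion h)
  | .B, .B => isTrue rfl

instance : Fintype Party where
  elems := {Party.A, Party.B}
  complete := fun i => by cases i <;> simp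

/-- The two-party election where the proportions of votes on `A`, `B` and `AB` are
`α`, `β` and `1 - α - β`. -/
noncomputable def twoPartyVotes (α β : ℝ) (σ : Finset Party) : ℝ :=
  if σ = {Party.A} then α
  else if σ = {Party.B} then β
  else if σ = {Party.A, Party.B} then 1 - α - β
  else 0

/-- The parameter `a` of the associated dynamical system. -/
noncomputable def parA (α β : ℝ) : ℝ :=
  α * β / ((1 - α) * (1 - β))

/-- The parameter `b'` of the associated dynamical system. -/
noncomputable def parB' (α β : ℝ) : ℝ :=
  (α - β) / β + α * (1 - α - β) / ((1 - α) * (1 - β))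

end Phragmen

/-! ### The dynamical system `f_±(x) = {f_-(x), f_+(x)}` and its rotation number -/

namespace ContractedRotation

/-- The left-continuous fractional part, with values in `(0, 1]`. -/
noncomputable def fractPlus (x : ℝ) : ℝ := 1 - Int.fract (-x)

/-- `f_-(x) = {a x + b}`. -/
noncomputable def fMinus (a b x : ℝ) : ℝ := Int.fract (a * x + b)

/-- `f_+(x) = {a x + b}_+`. -/
noncomputable def fPlus (a b x : ℝ) : ℝ := fractPlus (a * x + b)

/-- The lift `F_-` of `f_-`. -/
noncomputable def liftMinus (a b x : ℝ) : ℝ := a * x + b + (1 - a) * (⌊x⌋ : ℝ)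

/-- The lift `F_+` of `f_+`; it is the left-continuous version of `F_-`. -/
noncomputable def liftPlus (a b x : ℝ) : ℝ := a * x + b - (1 - a) * (⌊1 - x⌋ : ℝ)

theorem fract_liftMinus (a b x : ℝ) :
    Int.fract (liftMinus a b x) = fMinus a b (Int.fract x) := by
  have h : liftMinus a b x = a * Int.fract x + b + (⌊x⌋ : ℝ) := by
    unfold liftMinus Int.fract; ring
  rw [h, Int.fract_add_intCast, fMinus]

theorem fractPlus_liftPlus (a b x : ℝ) :
    fractPlus (liftPlus a b x) = fPlus a b (fractPlus x) := by
  have h : -(liftPlus a b x) = -(a * fractPlus x + b) + (⌊1 - x⌋ : ℝ) := by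
    have h1 : (1 : ℝ) - x = -x + 1 := by ring
    unfold liftPlus fractPlus Int.fract
    rw [h1, Int.floor_add_one]
    push_cast
    ring
  unfold fPlus
  rw [fractPlus, h, Int.fract_add_intCast]
  rfl

/-- `ρ` is the rotation number of `f_±` (with parameters `0 < a ≤ 1` and `0 ≤ b < 1`): for every
starting point, the iterates of both lifts have mean displacement `ρ` per step. -/
def IsRotationNumber (a b ρ : ℝ) : Prop :=
  ∀ x : ℝ, Tendsto (fun n : ℕ => (liftMinus a b)^[n] x / (n : ℝ)) atTop (𝓝 ρ) ∧
    Tendsto (fun n : ℕ => (liftPlus a b)^[n] x / (n : ℝ)) atTop (𝓝 ρ)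

end ContractedRotation

/-! ### The lifts `F_-` and `F_+` and their common rotation number -/

namespace ContractedRotation

/-! Let $\alpha\ge\beta>0$ and observe the election only at the seats of $B$. After such a seat the
state is coded by a threshold $c$: $B$ may get a seat once $A$ has received $k\ge c$ seats, and must
once $k>c$. When $B$ is elected, $y=1-k+c$ lies in $[0,1]$ and the next threshold is $ay+b'$, so
successive values of $y$ follow $y\mapsto ay+b'$ mod $1$; ties are the choice between the endpoints
$0$ and $1$. Lifting gives an orbit of $F_\pm$ whose integer part encodes the times of the seats of
$B$ (`IsThresholdRun.isOrbit`).

Both lifts are monotone of degree one and have the same translation number $\rho$. Every orbit is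
squeezed between their iterates, so $X_m=X_0+m\rho$ up to an error of at most $1$
(`IsOrbit.abs_sub_le`). Thus $B$ gets its $m$-th seat at time $m(2+\lfloor b'\rfloor+\rho)+O(1)$,
and inverting gives the shares. The case $\alpha<\beta$ follows by symmetry; if $\beta=0$, $A$ gets
everything.

If $a<1$, an orbit eventually uses only one branch (`eventually_single_branch`). For rational
$\rho$, monotonicity and boundedness then make its integer parts periodic up to translation
(`eventually_add_eq`). -/

theorem liftMinus_strictMono {a : ℝ} (b : ℝ) (ha : 0 < a) (ha1 : a ≤ 1) :
    StrictMono (liftMinus a b) := by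
  intro x y h
  have h1 : (⌊x⌋ : ℝ) ≤ ⌊y⌋ := by exact_mod_cast Int.floor_mono h.le
  have h2 := mul_lt_mul_of_pos_left h ha
  have h3 := mul_le_mul_of_nonneg_left h1 (sub_nonneg.2 ha1)
  unfold liftMinus
  linarith

theorem liftPlus_strictMono {a : ℝ} (b : ℝ) (ha : 0 < a) (ha1 : a ≤ 1) :
    StrictMono (liftPlus a b) := by
  intro x y h
  have h1 : (⌊1 - y⌋ : ℝ) ≤ ⌊1 - x⌋ := by
    exact_mod_cast Int.floor_mono (sub_le_sub_left h.le 1)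
  have h2 := mul_lt_mul_of_pos_left h ha
  have h3 := mul_le_mul_of_nonneg_left h1 (sub_nonneg.2 ha1)
  unfold liftPlus
  linarith

/-- Since `-⌊1 - y⌋ = ⌈y⌉ - 1 ≥ ⌊x⌋` for `x < y`, the jump terms keep their order. -/
theorem liftMinus_lt_liftPlus {a : ℝ} (b : ℝ) (ha : 0 < a) (ha1 : a ≤ 1) {x y : ℝ} (h : x < y) :
    liftMinus a b x < liftPlus a b y := by
  have h1 : (⌊x⌋ : ℝ) ≤ -⌊1 - y⌋ := by
    have h4 : ⌊x⌋ + ⌊1 - y⌋ < 1 := by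
      have h5 := Int.floor_le x
      have h6 := Int.floor_le (1 - y)
      have : ((⌊x⌋ + ⌊1 - y⌋ : ℤ) : ℝ) < ((1 : ℤ) : ℝ) := by push_cast; linarith
      exact_mod_cast this
    have h5 : ⌊x⌋ ≤ -⌊1 - y⌋ := by omega
    exact_mod_cast h5
  have h2 := mul_lt_mul_of_pos_left h ha
  have h3 := mul_le_mul_of_nonneg_left h1 (sub_nonneg.2 ha1)
  unfold liftMinus liftPlus
  linarith

theorem liftMinus_add_one (a b x : ℝ) : liftMinus a b (x + 1) = liftMinus a b x + 1 := by
  unfold liftMinus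
  rw [Int.floor_add_one]
  push_cast
  ring

theorem liftPlus_add_one (a b x : ℝ) : liftPlus a b (x + 1) = liftPlus a b x + 1 := by
  have h : 1 - x = 1 - (x + 1) + 1 := by ring
  unfold liftPlus
  rw [h, Int.floor_add_one]
  push_cast
  ring

/-- The lift `F_-` as a degree one monotone map. -/
noncomputable def circleMinus (a b : ℝ) (ha : 0 < a) (ha1 : a ≤ 1) : CircleDeg1Lift where
  toFun := liftMinus a b
  monotone' := (liftMinus_strictMono b ha ha1).monotone
  map_add_one' := liftMinus_add_one a b

/-- The lift `F_+` as a degree one monotone map. -/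
noncomputable def circlePlus (a b : ℝ) (ha : 0 < a) (ha1 : a ≤ 1) : CircleDeg1Lift where
  toFun := liftPlus a b
  monotone' := (liftPlus_strictMono b ha ha1).monotone
  map_add_one' := liftPlus_add_one a b

section
variable {a b : ℝ} (ha : 0 < a) (ha1 : a ≤ 1)

theorem coe_circleMinus : ⇑(circleMinus a b ha ha1) = liftMinus a b := rfl

theorem coe_circlePlus : ⇑(circlePlus a b ha ha1) = liftPlus a b := rfl

theorem floor_add_floor_one_sub_nonneg (x : ℝ) : (0 : ℝ) ≤ (⌊x⌋ : ℝ) + ⌊1 - x⌋ := by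
  have h5 := Int.lt_floor_add_one x
  have h6 := Int.lt_floor_add_one (1 - x)
  have h7 : ((-1 : ℤ) : ℝ) < ((⌊x⌋ + ⌊1 - x⌋ : ℤ) : ℝ) := by push_cast; linarith
  have h8 : -1 < ⌊x⌋ + ⌊1 - x⌋ := by exact_mod_cast h7
  have h9 : 0 ≤ ⌊x⌋ + ⌊1 - x⌋ := by omega
  exact_mod_cast h9

theorem circlePlus_le_circleMinus : circlePlus a b ha ha1 ≤ circleMinus a b ha ha1 := by
  intro x
  rw [coe_circlePlus, coe_circleMinus]
  have h3 := mul_nonneg (sub_nonneg.2 ha1) (floor_add_floor_one_sub_nonneg x)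
  unfold liftMinus liftPlus
  linarith

include ha ha1 in
theorem iterate_liftMinus_lt_iterate_liftPlus (n : ℕ) {x y : ℝ} (h : x < y) :
    (liftMinus a b)^[n] x < (liftPlus a b)^[n] y := by
  induction n generalizing x y with
  | zero => exact h
  | succ n ih => exact ih (liftMinus_lt_liftPlus b ha ha1 h)

/-- The iterates stay within distance 1: `F_+^n 0 ≤ F_-^n 0 < F_+^n 1 = F_+^n 0 + 1`. -/
theorem translationNumber_circlePlus :
    (circlePlus a b ha ha1).translationNumber = (circleMinus a b ha ha1).translationNumber := by
  refine CircleDeg1Lift.translationNumber_eq_of_dist_bounded 1 fun n => ?_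
  have h1 := CircleDeg1Lift.pow_mono (circlePlus_le_circleMinus (b := b) ha ha1) n 0
  have h2 := iterate_liftMinus_lt_iterate_liftPlus (b := b) ha ha1 n (zero_lt_one (α := ℝ))
  have h3 := (circlePlus a b ha ha1 ^ n).map_add_one 0
  rw [zero_add] at h3
  rw [← coe_circleMinus ha ha1, ← coe_circlePlus ha ha1, ← CircleDeg1Lift.coe_pow,
    ← CircleDeg1Lift.coe_pow, h3] at h2
  rw [Real.dist_eq, abs_le]
  constructor <;> linarith

theorem tendsto_iterate_div (f : CircleDeg1Lift) (x : ℝ) :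
    Tendsto (fun n : ℕ => f^[n] x / n) atTop (𝓝 f.translationNumber) := by
  have h1 := f.tendsto_translationNumber x
  have h2 : Tendsto (fun n : ℕ => x / (n : ℝ)) atTop (𝓝 0) :=
    tendsto_const_nhds.div_atTop tendsto_natCast_atTop_atTop
  have h3 := h1.add h2
  rw [add_zero] at h3
  refine h3.congr fun n => ?_
  rw [← add_div, sub_add_cancel, CircleDeg1Lift.coe_pow]

theorem isRotationNumber_translationNumber :
    IsRotationNumber a b (circleMinus a b ha ha1).translationNumber := by
  intro x
  refine ⟨tendsto_iterate_div (circleMinus a b ha ha1) x, ?_⟩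
  rw [← translationNumber_circlePlus]
  exact tendsto_iterate_div (circlePlus a b ha ha1) x

theorem translationNumber_circleMinus_nonneg (hb : 0 ≤ b) :
    0 ≤ (circleMinus a b ha ha1).translationNumber := by
  have h := (circleMinus a b ha ha1).le_translationNumber_of_add_int_le (x := 0) (m := 0)
    (by rw [coe_circleMinus]; simpa [liftMinus] using hb)
  simpa using h

end

/-! ### Orbits of the multivalued lift -/

/-- The one-step displacement bounds are applied to `f ^ n`, so the error does not grow with `n`. -/
theorem abs_iterate_sub_le (f : CircleDeg1Lift) (n : ℕ) (x : ℝ) :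
    |f^[n] x - x - n * f.translationNumber| ≤ 1 := by
  have h1 := (f ^ n).map_lt_add_translationNumber_add_one x
  have h2 := (f ^ n).translationNumber_le_ceil_sub x
  have h3 := Int.ceil_lt_add_one ((f ^ n) x - x)
  rw [CircleDeg1Lift.translationNumber_pow, CircleDeg1Lift.coe_pow] at *
  rw [abs_le]
  constructor <;> linarith

/-- `X` is an orbit of the multivalued lift with branches `F_-` and `F_+`; the integer part `N m`
of `X m` records which branch is used. -/
structure IsOrbit (a b : ℝ) (X : ℕ → ℝ) (N : ℕ → ℤ) : Prop where
  le (m : ℕ) : (N m : ℝ) ≤ X m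
  le_add_one (m : ℕ) : X m ≤ N m + 1
  succ (m : ℕ) : X (m + 1) = a * X m + b + (1 - a) * N m

namespace IsOrbit
variable {a b : ℝ} {X : ℕ → ℝ} {N : ℕ → ℤ} (ha : 0 < a) (ha1 : a ≤ 1)

include ha ha1 in
theorem le_iterate_liftMinus (h : IsOrbit a b X N) (m : ℕ) : X m ≤ (liftMinus a b)^[m] (X 0) := by
  induction m with
  | zero => exact le_rfl
  | succ m ih =>
    rw [Function.iterate_succ_apply']
    refine le_trans ?_ ((liftMinus_strictMono b ha ha1).monotone ih)
    have h1 : (N m : ℝ) ≤ ⌊X m⌋ := by exact_mod_cast Int.le_floor.2 (h.le m)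
    have h3 := mul_le_mul_of_nonneg_left h1 (sub_nonneg.2 ha1)
    rw [h.succ]
    unfold liftMinus
    linarith

include ha ha1 in
theorem iterate_liftPlus_le (h : IsOrbit a b X N) (m : ℕ) : (liftPlus a b)^[m] (X 0) ≤ X m := by
  induction m with
  | zero => exact le_rfl
  | succ m ih =>
    rw [Function.iterate_succ_apply']
    refine ((liftPlus_strictMono b ha ha1).monotone ih).trans ?_
    have h1 : ((-N m : ℤ) : ℝ) ≤ ⌊1 - X m⌋ := by
      have h2 : -N m ≤ ⌊1 - X m⌋ :=
        Int.le_floor.2 (by have := h.le_add_one m; push_cast; linarith)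
      exact_mod_cast h2
    push_cast at h1
    have h3 := mul_le_mul_of_nonneg_left h1 (sub_nonneg.2 ha1)
    rw [h.succ]
    unfold liftPlus
    linarith

theorem abs_sub_le (h : IsOrbit a b X N) (m : ℕ) :
    |X m - X 0 - m * (circleMinus a b ha ha1).translationNumber| ≤ 1 := by
  have h1 := abs_iterate_sub_le (circleMinus a b ha ha1) m (X 0)
  have h2 := abs_iterate_sub_le (circlePlus a b ha ha1) m (X 0)
  rw [translationNumber_circlePlus] at h2
  have h3 := h.le_iterate_liftMinus ha ha1 m
  have h4 := h.iterate_liftPlus_le ha ha1 m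
  rw [coe_circleMinus] at h1
  rw [coe_circlePlus] at h2
  rw [abs_le] at *
  constructor <;> linarith

theorem floor_eq (h : IsOrbit a b X N) {m : ℕ} (hm : X m ≠ N m + 1) : ⌊X m⌋ = N m :=
  Int.floor_eq_iff.2 ⟨h.le m, lt_of_le_of_ne (h.le_add_one m) hm⟩

theorem floor_one_sub_eq (h : IsOrbit a b X N) {m : ℕ} (hm : X m ≠ N m) :
    ⌊1 - X m⌋ = -N m := by
  have h1 := lt_of_le_of_ne (h.le m) hm.symm
  have h2 := h.le_add_one m
  refine Int.floor_eq_iff.2 ⟨?_, ?_⟩ <;> push_cast <;> linarith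

theorem succ_eq_liftMinus (h : IsOrbit a b X N) {m : ℕ} (hm : X m ≠ N m + 1) :
    X (m + 1) = liftMinus a b (X m) := by
  rw [h.succ, liftMinus, h.floor_eq hm]

theorem succ_eq_liftPlus (h : IsOrbit a b X N) {m : ℕ} (hm : X m ≠ N m) :
    X (m + 1) = liftPlus a b (X m) := by
  rw [h.succ, liftPlus, h.floor_one_sub_eq hm]
  push_cast
  ring

/-- If an orbit uses the branch `f` at an integer point and later returns to an integer point,
then `f` maps `0` to an integer after some number of steps. -/
theorem exists_iterate_zero_eq (f : CircleDeg1Lift) {m : ℕ} {z : ℤ} (hz : X m = z)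
    (hf : X (m + 1) = f (X m))
    (hX : ∀ j, m < j → X j ≠ N j → X j ≠ N j + 1 → X (j + 1) = f (X j))
    (hret : ∃ n, m < n ∧ (X n = N n ∨ X n = N n + 1)) :
    ∃ k : ℕ, 0 < k ∧ ∃ w : ℤ, (f ^ k) 0 = 0 + w := by
  classical
  obtain ⟨hmn, hn⟩ := Nat.find_spec hret
  set n := Nat.find hret
  -- Strictly between `m` and the first return `n` the orbit avoids both endpoints, so every step
  -- there is a step of `f`.
  have key : ∀ j, m + 1 + j ≤ n → X (m + 1 + j) = f^[j + 1] (X m) := by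
    intro j
    induction j with
    | zero => intro _; simpa using hf
    | succ j ih =>
      intro hj
      have hnot := Nat.find_min hret (m := m + 1 + j) (by omega)
      rw [Function.iterate_succ_apply', ← ih (by omega)]
      refine hX (m + 1 + j) (by omega) (fun h1 => hnot ⟨by omega, .inl h1⟩)
        (fun h1 => hnot ⟨by omega, .inr h1⟩)
  obtain ⟨w, hw⟩ : ∃ w : ℤ, X n = w := by
    rcases hn with hn | hn
    · exact ⟨_, hn⟩
    · exact ⟨N n + 1, by rw [hn]; push_cast; ring⟩
  have h1 := key (n - (m + 1)) (by omega)
  rw [show m + 1 + (n - (m + 1)) = n by omega, hw, ← CircleDeg1Lift.coe_pow, hz,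
    CircleDeg1Lift.map_int_of_map_zero] at h1
  exact ⟨n - (m + 1) + 1, by omega, w - z, by push_cast; linarith⟩

/-- The jump of size `1 - a` at `0` separates the branches at the first step, and monotonicity
preserves the gap. -/
theorem iterate_zero_lt (ha' : a < 1) {n : ℕ} (hn : 0 < n) :
    (circlePlus a b ha ha1 ^ n) 0 < (circleMinus a b ha ha1 ^ n) 0 := by
  obtain ⟨n, rfl⟩ := Nat.exists_eq_succ_of_ne_zero hn.ne'
  have h0 : liftPlus a b 0 < liftMinus a b 0 := by simp [liftPlus, liftMinus]; linarith
  rw [CircleDeg1Lift.coe_pow, CircleDeg1Lift.coe_pow, Function.iterate_succ_apply,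
    Function.iterate_succ_apply]
  refine lt_of_lt_of_le ((liftPlus_strictMono b ha ha1).iterate n h0) ?_
  exact CircleDeg1Lift.iterate_mono (circlePlus_le_circleMinus ha ha1) n _

-- If both endpoints were met infinitely often, `0` would return to an integer under each branch:
-- `F_-^k 0 = w` and `F_+^l 0 = u`. The common rotation number gives `w / k = u / l`, so the
-- branches would agree at `0` after `k * l` steps, contrary to `iterate_zero_lt`.
include ha in
theorem eventually_single_branch (h : IsOrbit a b X N) (ha' : a < 1) :
    ∃ M, (∀ m, M ≤ m → X m ≠ N m + 1) ∨ (∀ m, M ≤ m → X m ≠ N m) := by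
  by_contra! hcon
  obtain ⟨m₁, -, hm₁⟩ := (hcon 0).2
  obtain ⟨m₂, -, hm₂⟩ := (hcon 0).1
  have hne1 : X m₁ ≠ N m₁ + 1 := by rw [hm₁]; linarith
  have hne2 : X m₂ ≠ N m₂ := by rw [hm₂]; linarith
  obtain ⟨k, hk, w, hw⟩ := exists_iterate_zero_eq (X := X) (N := N) (circleMinus a b ha ha'.le)
    hm₁ (h.succ_eq_liftMinus hne1) (fun j _ _ hj => h.succ_eq_liftMinus hj) (by
      obtain ⟨n, hn, hn'⟩ := (hcon (m₁ + 1)).2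
      exact ⟨n, by omega, .inl hn'⟩)
  obtain ⟨l, hl, u, hu⟩ := exists_iterate_zero_eq (X := X) (N := N) (circlePlus a b ha ha'.le)
    (z := N m₂ + 1) (by rw [hm₂]; push_cast; ring) (h.succ_eq_liftPlus hne2)
    (fun j _ hj _ => h.succ_eq_liftPlus hj) (by
      obtain ⟨n, hn, hn'⟩ := (hcon (m₂ + 1)).2
      exact ⟨n, by omega, .inl hn'⟩)
  have h1 := CircleDeg1Lift.translationNumber_of_map_pow_eq_add_int _ hw hk
  have h2 := CircleDeg1Lift.translationNumber_of_map_pow_eq_add_int _ hu hl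
  rw [translationNumber_circlePlus, h1, div_eq_div_iff (by positivity) (by positivity)] at h2
  have h3 := CircleDeg1Lift.iterate_eq_of_map_eq_add_int _ hw l
  have h4 := CircleDeg1Lift.iterate_eq_of_map_eq_add_int _ hu k
  rw [← CircleDeg1Lift.coe_pow, ← pow_mul] at h3 h4
  have h5 := iterate_zero_lt (b := b) ha ha'.le ha' (Nat.mul_pos hk hl)
  rw [h3, mul_comm k l, h4] at h5
  linarith

end IsOrbit

/-! ### Rational rotation number and periodic integer parts -/

theorem eventually_eq_succ_of_bounded {u : ℕ → ℤ} {M : ℕ} {C : ℤ}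
    (hu : ∀ m, M ≤ m → u m ≤ u (m + 1)) (hC : ∀ m, u m ≤ C) :
    ∃ M', ∀ m, M' ≤ m → u (m + 1) = u m := by
  obtain ⟨z, ⟨m₀, hm₀, hz⟩, hmax⟩ := Int.exists_greatest_of_bdd (P := fun z => ∃ m, M ≤ m ∧ u m = z)
    ⟨C, by rintro z ⟨m, -, rfl⟩; exact hC m⟩ ⟨_, M, le_rfl, rfl⟩
  have key : ∀ m, m₀ ≤ m → u m = z := by
    intro m hm
    induction m, hm using Nat.le_induction with
    | base => exact hz
    | succ m hm ih =>
      exact le_antisymm (hmax _ ⟨m + 1, by omega, rfl⟩) (ih ▸ hu m (by omega))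
  exact ⟨m₀, fun m hm => by rw [key m hm, key (m + 1) (by omega)]⟩

/-- The integer parts along an orbit of a single branch with rational rotation number are
eventually periodic, up to translation. -/
theorem eventually_add_eq (f : CircleDeg1Lift) {X : ℕ → ℝ} {N : ℕ → ℤ} {ν : ℝ → ℤ}
    (hν : Monotone ν) (hν1 : ∀ x (k : ℤ), ν (x + k) = ν x + k) {M q : ℕ} {p : ℤ}
    {C ρ : ℝ} (hρ : ρ * q = p)
    (hf : ∀ m, M ≤ m → X (m + 1) = f (X m)) (hN : ∀ m, M ≤ m → ν (X m) = N m)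
    (hC : ∀ m, |(N m : ℝ) - m * ρ| ≤ C) :
    ∃ M', ∀ m, M' ≤ m → N (m + q) = N m + p := by
  -- The increments of this window sum are `N (m + q) - N m - p`, so it suffices that `Z` is
  -- eventually constant. It is bounded because `ρ * q = p`.
  set Z : ℕ → ℤ := fun m => ∑ i ∈ Finset.range q, N (m + i) - m * p with hZ
  have hZ1 : ∀ m, Z (m + 1) - Z m = N (m + q) - N m - p := by
    intro m
    have h1 := Finset.sum_range_succ (fun i => N (m + i)) q
    have h2 := Finset.sum_range_succ' (fun i => N (m + i)) q
    have h3 : ∑ i ∈ Finset.range q, N (m + 1 + i) = ∑ i ∈ Finset.range q, N (m + (i + 1)) :=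
      Finset.sum_congr rfl fun i _ => by rw [add_assoc, add_comm 1 i]
    simp only [hZ, h3]
    push_cast
    simp only [add_zero] at h2
    linarith
  have hZC : ∀ m, |(Z m : ℝ)| ≤ q * (C + q * |ρ|) := by
    intro m
    have h1 : (Z m : ℝ) = ∑ i ∈ Finset.range q, ((N (m + i) : ℝ) - m * ρ) := by
      simp only [hZ, Finset.sum_sub_distrib, Finset.sum_const, Finset.card_range, nsmul_eq_mul]
      push_cast
      rw [← hρ]
      ring
    rw [h1]
    refine (Finset.abs_sum_le_sum_abs _ _).trans ?_
    refine (Finset.sum_le_card_nsmul _ _ (C + q * |ρ|) fun i hi => ?_).trans (by simp [mul_add])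
    have h2 : (N (m + i) : ℝ) - m * ρ = (N (m + i) - (m + i : ℕ) * ρ) + i * ρ := by
      push_cast; ring
    rw [h2]
    refine (abs_add_le _ _).trans (add_le_add (hC _) ?_)
    rw [abs_mul, Nat.abs_cast]
    exact mul_le_mul_of_nonneg_right (by exact_mod_cast (Finset.mem_range.1 hi).le) (abs_nonneg ρ)
  obtain ⟨D, hD⟩ := exists_int_gt ((q : ℝ) * (C + q * |ρ|))
  have hZD : ∀ m, Z m ≤ D ∧ -Z m ≤ D := by
    intro m
    have h1 := abs_le.1 (hZC m)
    constructor
    · have : (Z m : ℝ) ≤ D := by linarith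
      exact_mod_cast this
    · have : ((-Z m : ℤ) : ℝ) ≤ D := by push_cast; linarith
      exact_mod_cast this
  suffices h : ∃ M', ∀ m, M' ≤ m → Z (m + 1) = Z m by
    obtain ⟨M', hM'⟩ := h
    exact ⟨M', fun m hm => by have h1 := hM' m hm; have h2 := hZ1 m; omega⟩
  -- The order of `X m + p` and `X (m + q)` persists, since `f` is monotone and commutes with
  -- integer translations. Applying `ν` makes `Z` monotone in either case.
  rcases le_total (X M + p) (X (M + q)) with h0 | h0
  · have h1 : ∀ m, M ≤ m → X m + p ≤ X (m + q) := by
      intro m hm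
      induction m, hm using Nat.le_induction with
      | base => exact h0
      | succ m hm ih =>
        rw [show m + 1 + q = m + q + 1 by ring, hf m hm, hf (m + q) (by omega),
          ← CircleDeg1Lift.map_add_int]
        exact f.monotone ih
    refine eventually_eq_succ_of_bounded (M := M) (fun m hm => ?_) (fun m => (hZD m).1)
    have h2 := hν (h1 m hm)
    rw [hν1, hN m hm, hN (m + q) (by omega)] at h2
    have := hZ1 m
    omega
  · have h1 : ∀ m, M ≤ m → X (m + q) ≤ X m + p := by
      intro m hm
      induction m, hm using Nat.le_induction with
      | base => exact h0
      | succ m hm ih =>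
        rw [show m + 1 + q = m + q + 1 by ring, hf m hm, hf (m + q) (by omega),
          ← CircleDeg1Lift.map_add_int]
        exact f.monotone ih
    obtain ⟨M', hM'⟩ := eventually_eq_succ_of_bounded (u := fun m => -Z m) (M := M) (C := D)
      (fun m hm => by
        have h2 := hν (h1 m hm)
        rw [hν1, hN m hm, hN (m + q) (by omega)] at h2
        have := hZ1 m
        omega) (fun m => (hZD m).2)
    exact ⟨M', fun m hm => neg_injective (hM' m hm)⟩

theorem IsOrbit.exists_eventually_add_eq {a b : ℝ} {X : ℕ → ℝ} {N : ℕ → ℤ} (h : IsOrbit a b X N)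
    (ha : 0 < a) (ha' : a < 1) {r : ℚ}
    (hr : (r : ℝ) = (circleMinus a b ha ha'.le).translationNumber) :
    ∃ q : ℕ, 0 < q ∧ ∃ p : ℤ, ∃ M, ∀ m, M ≤ m → N (m + q) = N m + p := by
  refine ⟨r.den, r.pos, r.num, ?_⟩
  have hρ : (circleMinus a b ha ha'.le).translationNumber * r.den = r.num := by
    rw [← hr]
    exact_mod_cast r.mul_den_eq_num
  have hC : ∀ m, |(N m : ℝ) - m * (circleMinus a b ha ha'.le).translationNumber| ≤ 2 + |X 0| := by
    intro m
    have h1 := abs_le.1 (h.abs_sub_le ha ha'.le m)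
    have h2 := h.le m
    have h3 := h.le_add_one m
    have h4 := abs_le.1 (le_refl |X 0|)
    rw [abs_le]
    constructor <;> linarith
  obtain ⟨M, hM | hM⟩ := h.eventually_single_branch ha ha'
  · exact eventually_add_eq (circleMinus a b ha ha'.le) Int.floor_mono
      (fun x k => Int.floor_add_intCast x k) hρ (fun m hm => h.succ_eq_liftMinus (hM m hm))
      (fun m hm => h.floor_eq (hM m hm)) hC
  -- Here `ν x = ⌈x⌉ - 1`, the integer part adapted to the intervals `(n, n + 1]`.
  · refine eventually_add_eq (circlePlus a b ha ha'.le) (ν := fun x => -⌊1 - x⌋)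
      (fun x y hxy => neg_le_neg (Int.floor_mono (sub_le_sub_left hxy 1)))
      (fun x k => ?_) hρ (fun m hm => h.succ_eq_liftPlus (hM m hm))
      (fun m hm => by rw [h.floor_one_sub_eq (hM m hm), neg_neg]) hC
    rw [show 1 - (x + k) = 1 - x - k by ring, Int.floor_sub_intCast]
    ring

end ContractedRotation

/-! ### The election in two coordinates -/

namespace Phragmen

theorem filter_mem_A : (Finset.univ.filter fun σ : Finset Party => Party.A ∈ σ) =
    {{Party.A}, {Party.A, Party.B}} := by decide

theorem filter_mem_B : (Finset.univ.filter fun σ : Finset Party => Party.B ∈ σ) =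
    {{Party.B}, {Party.A, Party.B}} := by decide

theorem power_A (α β : ℝ) (x : Finset Party → ℝ) :
    power (twoPartyVotes α β) x Party.A =
      α * x {Party.A} + (1 - α - β) * x {Party.A, Party.B} := by
  have h1 : ({Party.A, Party.B} : Finset Party) ≠ {Party.A} := by decide
  have h2 : ({Party.A, Party.B} : Finset Party) ≠ {Party.B} := by decide
  rw [power, filter_mem_A, Finset.sum_pair h1.symm]
  simp only [twoPartyVotes, if_true, if_neg h1, if_neg h2]

theorem power_B (α β : ℝ) (x : Finset Party → ℝ) :
    power (twoPartyVotes α β) x Party.B =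
      β * x {Party.B} + (1 - α - β) * x {Party.A, Party.B} := by
  have h1 : ({Party.A, Party.B} : Finset Party) ≠ {Party.A} := by decide
  have h2 : ({Party.A, Party.B} : Finset Party) ≠ {Party.B} := by decide
  have h3 : ({Party.B} : Finset Party) ≠ {Party.A} := by decide
  rw [power, filter_mem_B, Finset.sum_pair h2.symm]
  simp only [twoPartyVotes, if_true, if_neg h1, if_neg h2, if_neg h3]

/-- A run of the two-party election, in terms of the free voting powers `p` and `q` of the ballots
naming `A` only and `B` only; the free voting power of the ballots naming both always vanishes. -/
structure IsCoordinateRun (α β : ℝ) (s : ℕ → Party) (p q : ℕ → ℝ) : Prop where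
  p_zero : p 0 = 0
  q_zero : q 0 = 0
  of_A (n : ℕ) : s n = Party.A → β ≠ 1 ∧ p (n + 1) = 0 ∧
    q (n + 1) = q n + (1 - α * p n) / (1 - β) ∧
    (α ≠ 1 → (1 - α * p n) / (1 - β) ≤ (1 - β * q n) / (1 - α))
  of_B (n : ℕ) : s n = Party.B → α ≠ 1 ∧ q (n + 1) = 0 ∧
    p (n + 1) = p n + (1 - β * q n) / (1 - α) ∧
    (β ≠ 1 → (1 - β * q n) / (1 - α) ≤ (1 - α * p n) / (1 - β))

theorem requires_A_iff {α β Δ : ℝ} {x : Finset Party → ℝ} (hx : x {Party.A, Party.B} = 0) :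
    Requires (twoPartyVotes α β) x Party.A Δ ↔ α * x {Party.A} + (1 - β) * Δ = 1 := by
  rw [Requires, power_A, hx]
  constructor <;> intro h <;> linarith

theorem requires_B_iff {α β Δ : ℝ} {x : Finset Party → ℝ} (hx : x {Party.A, Party.B} = 0) :
    Requires (twoPartyVotes α β) x Party.B Δ ↔ β * x {Party.B} + (1 - α) * Δ = 1 := by
  rw [Requires, power_B, hx]
  constructor <;> intro h <;> linarith

theorem IsSeatSequence.exists_isCoordinateRun {α β : ℝ} {s : ℕ → Party}
    (hα : 0 ≤ α) (hβ : 0 ≤ β) (hαβ : α + β ≤ 1)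
    (h : IsSeatSequence (twoPartyVotes α β) s) : ∃ p q, IsCoordinateRun α β s p q := by
  obtain ⟨x, hx0, hx⟩ := h
  -- Whoever is elected is named on these ballots, so each seat resets their power.
  have hAB : ∀ n, x n {Party.A, Party.B} = 0 := by
    intro n
    cases n with
    | zero => rw [hx0]; rfl
    | succ n =>
      obtain ⟨Δ, -, -, h3⟩ := hx n
      rw [h3]
      have : s n ∈ ({Party.A, Party.B} : Finset Party) := by cases s n <;> decide
      simp [this]
  have hmul : ∀ {u Δ c : ℝ}, c ≠ 1 → (u + (1 - c) * Δ = 1 ↔ Δ = (1 - u) / (1 - c)) := by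
    intro u Δ c hc
    rw [eq_div_iff (sub_ne_zero.2 hc.symm)]
    constructor <;> intro h <;> linarith
  -- If `β = 1`, the equation required by `A` becomes `0 = 1`; likewise for `B` if `α = 1`. Hence
  -- the divisors are nonzero whenever the party is elected.
  have hpA : β = 1 → α = 0 := fun h => by linarith
  have hpB : α = 1 → β = 0 := fun h => by linarith
  refine ⟨fun n => x n {Party.A}, fun n => x n {Party.B}, by simp [hx0], by simp [hx0], ?_, ?_⟩
  · intro n hn
    obtain ⟨Δ, h1, h2, h3⟩ := hx n
    rw [hn] at h1 h3
    rw [requires_A_iff (hAB n)] at h1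
    have hβ1 : β ≠ 1 := fun hb => by rw [hpA hb, hb] at h1; norm_num at h1
    rw [hmul hβ1] at h1
    refine ⟨hβ1, by rw [h3]; simp, by rw [h3, ← h1]; simp, fun hα1 => ?_⟩
    rw [← h1]
    exact h2 Party.B _ ((requires_B_iff (hAB n)).2 ((hmul hα1).2 rfl))
  · intro n hn
    obtain ⟨Δ, h1, h2, h3⟩ := hx n
    rw [hn] at h1 h3
    rw [requires_B_iff (hAB n)] at h1
    have hα1 : α ≠ 1 := fun hb => by rw [hpB hb, hb] at h1; norm_num at h1
    rw [hmul hα1] at h1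
    refine ⟨hα1, by rw [h3]; simp, by rw [h3, ← h1]; simp, fun hβ1 => ?_⟩
    rw [← h1]
    exact h2 Party.A _ ((requires_A_iff (hAB n)).2 ((hmul hβ1).2 rfl))

/-- Interchange of the two parties. -/
def Party.swap : Party → Party
  | .A => .B
  | .B => .A

theorem Party.swap_eq_A {i : Party} : i.swap = .A ↔ i = .B := by cases i <;> simp [Party.swap]

theorem Party.swap_eq_B {i : Party} : i.swap = .B ↔ i = .A := by cases i <;> simp [Party.swap]

theorem IsCoordinateRun.swap {α β : ℝ} {s : ℕ → Party} {p q : ℕ → ℝ}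
    (h : IsCoordinateRun α β s p q) : IsCoordinateRun β α (fun n => (s n).swap) q p :=
  ⟨h.q_zero, h.p_zero, fun n hn => h.of_B n (Party.swap_eq_A.1 hn),
    fun n hn => h.of_A n (Party.swap_eq_B.1 hn)⟩

/-! ### The threshold for the next seat of `B` -/

/-- A run of the two-party election organized by the seats of `B`: `k n` is the number of seats
given to `A` since the last seat of `B`, and `c n` is the threshold which `k n` has to reach before
the next seat is given to `B`. -/
structure IsThresholdRun (a b' c₀ : ℝ) (s : ℕ → Party) (c : ℕ → ℝ) (k : ℕ → ℕ) : Prop where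
  c_zero : c 0 = c₀
  k_zero : k 0 = 0
  of_A (n : ℕ) : s n = Party.A → c (n + 1) = c n ∧ k (n + 1) = k n + 1
  of_B (n : ℕ) : s n = Party.B → c n ≤ k n ∧ c (n + 1) = a * (1 - k n + c n) + b' ∧ k (n + 1) = 0
  k_le (n : ℕ) : (k n : ℝ) ≤ c n + 1

/-- The threshold and the number of seats of `A` since the last seat of `B`. -/
noncomputable def thresholdState (α β : ℝ) (s : ℕ → Party) : ℕ → ℝ × ℕ
  | 0 => ((α - β) / β, 0)
  | n + 1 =>
    if s n = Party.A then ((thresholdState α β s n).1, (thresholdState α β s n).2 + 1)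
    else (parA α β * (1 - (thresholdState α β s n).2 + (thresholdState α β s n).1) + parB' α β, 0)

/-- The relation between the free voting powers `p`, `q` and the threshold `c` when `A` has been
given `k` seats since the last seat of `B`. -/
structure ThresholdInvariant (α β p q c : ℝ) (k : ℕ) : Prop where
  le_c : (α - β) / β ≤ c
  k_le : (k : ℝ) ≤ c + 1
  of_k_eq_zero : k = 0 → q = 0 ∧ α * p = c - (α - β) / β
  of_k_pos : 0 < k → p = 0 ∧ (1 - β) * q = k - (c - (α - β) / β)

/-- This fixes the constant `b'`. With `d = (α - β) / β`, a seat of `B` leaves `α * p = α / (1 - α)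
- a * (k - c + d)`, which has to equal `a * (1 - k + c) + b' - d`. -/
theorem threshold_identity {α β : ℝ} (hβ : β ≠ 0) (hα1 : α < 1) (hβ1 : β < 1) :
    α / (1 - α) - parA α β * ((α - β) / β) + (α - β) / β = parA α β + parB' α β := by
  have h1 : 1 - α ≠ 0 := by linarith
  have h2 : 1 - β ≠ 0 := by linarith
  unfold parA parB'
  field_simp
  ring

section
variable {α β : ℝ} (hβ : 0 < β) (hβα : β ≤ α) (hαβ : α + β ≤ 1)
include hβ hβα hαβ

theorem parA_pos : 0 < parA α β := by
  have h1 : 0 < 1 - α := by linarith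
  have h2 : 0 < 1 - β := by linarith
  have h3 : 0 < α := by linarith
  unfold parA
  positivity

theorem parA_le_one : parA α β ≤ 1 := by
  have h1 : 0 < 1 - α := by linarith
  have h2 : 0 < 1 - β := by linarith
  rw [parA, div_le_one (by positivity)]
  nlinarith

theorem parA_lt_one_iff : parA α β < 1 ↔ 0 < 1 - α - β := by
  have h1 : 0 < 1 - α := by linarith
  have h2 : 0 < 1 - β := by linarith
  rw [parA, div_lt_one (by positivity)]
  constructor <;> intro h <;> linarith

theorem le_parB' : (α - β) / β ≤ parB' α β := by
  have h1 : 0 < 1 - α := by linarith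
  have h2 : 0 < 1 - β := by linarith
  have h3 : 0 ≤ 1 - α - β := by linarith
  have h4 : 0 < α := by linarith
  exact le_add_of_nonneg_right (by positivity)

theorem parB'_nonneg : 0 ≤ parB' α β :=
  (div_nonneg (sub_nonneg.2 hβα) hβ.le).trans (le_parB' hβ hβα hαβ)

/-- For `k > 0` we have `p = 0`, and the minimality of `A` reduces to `β * (1 - β) * q ≤ α - β`,
that is, `k ≤ c`. For `k = 0` the bound only needs `0 ≤ c`. -/
theorem ThresholdInvariant.step_A {p q c : ℝ} {k : ℕ} (h : ThresholdInvariant α β p q c k)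
    (hle : (1 - α * p) / (1 - β) ≤ (1 - β * q) / (1 - α)) :
    ThresholdInvariant α β 0 (q + (1 - α * p) / (1 - β)) c (k + 1) := by
  have h1 : 0 < 1 - α := by linarith
  have h2 : 0 < 1 - β := by linarith
  have hd : β * ((α - β) / β) = α - β := mul_div_cancel₀ _ hβ.ne'
  have hd0 : 0 ≤ (α - β) / β := div_nonneg (sub_nonneg.2 hβα) hβ.le
  have hq : (1 - β) * (q + (1 - α * p) / (1 - β)) = (1 - β) * q + (1 - α * p) := by
    field_simp
  refine ⟨h.le_c, ?_, fun hk => by omega, fun _ => ⟨rfl, ?_⟩⟩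
  · push_cast
    rcases Nat.eq_zero_or_pos k with hk | hk
    · have := h.le_c
      rw [hk]
      push_cast
      linarith
    · obtain ⟨hp, hkq⟩ := h.of_k_pos hk
      rw [div_le_div_iff₀ h2 h1, hp] at hle
      have h3 : β * ((1 - β) * q) ≤ α - β := by linarith
      rw [hkq, mul_sub, mul_sub, hd] at h3
      have h4 : (k : ℝ) ≤ c := le_of_mul_le_mul_left (by linarith) hβ
      linarith
  · rw [hq]
    push_cast
    rcases Nat.eq_zero_or_pos k with hk | hk
    · obtain ⟨hq0, hp⟩ := h.of_k_eq_zero hk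
      rw [hq0, hp, hk]
      push_cast
      ring
    · obtain ⟨hp, hkq⟩ := h.of_k_pos hk
      rw [hp, hkq]
      ring

theorem ThresholdInvariant.step_B {p q c : ℝ} {k : ℕ} (h : ThresholdInvariant α β p q c k)
    (hle : (1 - β * q) / (1 - α) ≤ (1 - α * p) / (1 - β)) :
    c ≤ k ∧ ThresholdInvariant α β (p + (1 - β * q) / (1 - α)) 0
      (parA α β * (1 - k + c) + parB' α β) 0 := by
  have h1 : 0 < 1 - α := by linarith
  have h2 : 0 < 1 - β := by linarith
  have hα : 0 < α := by linarith
  have hd : β * ((α - β) / β) = α - β := mul_div_cancel₀ _ hβ.ne'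
  have hd0 : 0 ≤ (α - β) / β := div_nonneg (sub_nonneg.2 hβα) hβ.le
  have ha := parA_pos hβ hβα hαβ
  have hid := threshold_identity (α := α) hβ.ne' (by linarith) (by linarith)
  rw [div_le_div_iff₀ h1 h2] at hle
  have hck : c ≤ k ∧ p = 0 ∧ (1 - β) * q = k - (c - (α - β) / β) := by
    rcases Nat.eq_zero_or_pos k with hk | hk
    -- With no seat of `A` since the last seat of `B`, electing `B` is possible only in a tie with
    -- `α = β`, `c = 0` and `p = 0`.
    · obtain ⟨hq0, hp⟩ := h.of_k_eq_zero hk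
      have hle_c := h.le_c
      rw [hq0, hp] at hle
      have h3 : 0 ≤ (c - (α - β) / β) * (1 - α) := mul_nonneg (by linarith) h1.le
      have h4 : α = β := by linarith
      have h5 : (c - (α - β) / β) * (1 - α) = 0 := by linarith
      have h6 : c - (α - β) / β = 0 := (mul_eq_zero.1 h5).resolve_right h1.ne'
      have h7 : (α - β) / β = 0 := by rw [h4]; simp
      rw [h6] at hp
      refine ⟨by rw [hk]; push_cast; linarith, (mul_eq_zero.1 hp).resolve_left hα.ne', ?_⟩
      rw [hq0, hk, h6]
      simp
    · obtain ⟨hp, hkq⟩ := h.of_k_pos hk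
      rw [hp] at hle
      have h3 : α - β ≤ β * ((1 - β) * q) := by linarith
      rw [hkq, mul_sub, mul_sub, hd] at h3
      exact ⟨le_of_mul_le_mul_left (by linarith) hβ, hp, hkq⟩
  obtain ⟨hck, hp, hkq⟩ := hck
  have hnn : 0 ≤ parA α β * (1 - k + c) := mul_nonneg ha.le (by linarith [h.k_le])
  have hb' := le_parB' hβ hβα hαβ
  refine ⟨hck, by linarith, by push_cast; linarith, fun _ => ⟨rfl, ?_⟩, fun hk => by omega⟩
  have h8 : α * ((1 - β * q) / (1 - α)) = α / (1 - α) - parA α β * ((1 - β) * q) := by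
    unfold parA
    field_simp
  rw [hp, zero_add, h8, hkq]
  linarith

theorem IsCoordinateRun.isThresholdRun {s : ℕ → Party} {p q : ℕ → ℝ}
    (h : IsCoordinateRun α β s p q) :
    IsThresholdRun (parA α β) (parB' α β) ((α - β) / β) s
      (fun n => (thresholdState α β s n).1) (fun n => (thresholdState α β s n).2) := by
  have hα1 : α ≠ 1 := by linarith
  have hβ1 : β ≠ 1 := by linarith
  have hd0 : 0 ≤ (α - β) / β := div_nonneg (sub_nonneg.2 hβα) hβ.le
  have inv : ∀ n, ThresholdInvariant α β (p n) (q n)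
      (thresholdState α β s n).1 (thresholdState α β s n).2 := by
    intro n
    induction n with
    | zero =>
      rw [h.p_zero, h.q_zero]
      exact ⟨le_rfl, by simp only [thresholdState]; push_cast; linarith,
        fun _ => ⟨rfl, by simp [thresholdState]⟩, fun hk => absurd hk (by simp [thresholdState])⟩
    | succ n ih =>
      cases hn : s n with
      | A =>
        obtain ⟨-, h1, h2, h3⟩ := h.of_A n hn
        rw [thresholdState, if_pos hn, h1, h2]
        exact ih.step_A hβ hβα hαβ (h3 hα1)
      | B =>
        obtain ⟨-, h1, h2, h3⟩ := h.of_B n hn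
        rw [thresholdState, if_neg (by simp [hn]), h1, h2]
        exact (ih.step_B hβ hβα hαβ (h3 hβ1)).2
  refine ⟨rfl, rfl, fun n hn => ?_, fun n hn => ⟨?_, ?_⟩, fun n => (inv n).k_le⟩
  · simp [thresholdState, hn]
  · exact ((inv n).step_B hβ hβα hαβ ((h.of_B n hn).2.2.2 hβ1)).1
  · simp [thresholdState, hn]

end

end Phragmen

/-! ### Seat times of `B` as an orbit of the lift -/

namespace Phragmen

theorem seats_eq_count (s : ℕ → Party) (i : Party) (n : ℕ) :
    seats s i n = Nat.count (fun k => s k = i) n :=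
  (Nat.count_eq_card_filter_range _ _).symm

theorem seats_A_add_seats_B (s : ℕ → Party) (n : ℕ) :
    seats s Party.A n + seats s Party.B n = n := by
  simp only [seats_eq_count]
  induction n with
  | zero => simp
  | succ n ih =>
    rw [Nat.count_succ, Nat.count_succ]
    cases s n <;> simp <;> omega

namespace IsThresholdRun

variable {a b' c₀ : ℝ} {s : ℕ → Party} {c : ℕ → ℝ} {k : ℕ → ℕ}

/-- A bound free of `s` makes the final error constant independent of tie-breaking. -/
theorem c_le (h : IsThresholdRun a b' c₀ s c k) (ha : 0 ≤ a) (hb' : 0 ≤ b') (hc₀ : 0 ≤ c₀) (n : ℕ) :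
    c n ≤ c₀ + a + b' := by
  induction n with
  | zero => rw [h.c_zero]; linarith
  | succ n ih =>
    cases hn : s n with
    | A => rw [(h.of_A n hn).1]; exact ih
    | B =>
      obtain ⟨h1, h2, -⟩ := h.of_B n hn
      have h3 : a * (1 - k n + c n) ≤ a * 1 := mul_le_mul_of_nonneg_left (by linarith) ha
      rw [h2]
      linarith

theorem add_of_forall_A (h : IsThresholdRun a b' c₀ s c k) {n j : ℕ}
    (hA : ∀ i, n ≤ i → i < n + j → s i = Party.A) : c (n + j) = c n ∧ k (n + j) = k n + j := by
  induction j with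
  | zero => exact ⟨rfl, rfl⟩
  | succ j ih =>
    obtain ⟨h1, h2⟩ := ih fun i hi hi' => hA i hi (by omega)
    obtain ⟨h3, h4⟩ := h.of_A (n + j) (hA _ (by omega) (by omega))
    rw [← add_assoc, h3, h4, h1, h2]
    exact ⟨rfl, rfl⟩

/-- Otherwise `k` would grow forever below a constant `c + 1`. -/
theorem infinite_B (h : IsThresholdRun a b' c₀ s c k) : (Set.ofPred fun n => s n = Party.B).Infinite := by
  refine Set.infinite_of_not_bddAbove fun ⟨M, hM⟩ => ?_
  have hA : ∀ i, M + 1 ≤ i → s i = Party.A := by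
    intro i hi
    cases hs : s i with
    | A => rfl
    | B => exact absurd (hM hs) (by omega)
  obtain ⟨j, hj⟩ := exists_nat_gt (c (M + 1) + 1)
  obtain ⟨h1, h2⟩ := h.add_of_forall_A (n := M + 1) (j := j) fun i hi _ => hA i hi
  have h3 := h.k_le (M + 1 + j)
  rw [h1, h2] at h3
  push_cast at h3
  have : (0 : ℝ) ≤ k (M + 1) := Nat.cast_nonneg _
  linarith

/-- The time at which `B` gets its seat number `m + 1`. -/
noncomputable def timeB (s : ℕ → Party) (m : ℕ) : ℕ := Nat.nth (fun n => s n = Party.B) m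

theorem apply_timeB (h : IsThresholdRun a b' c₀ s c k) (m : ℕ) : s (timeB s m) = Party.B :=
  Nat.nth_mem_of_infinite h.infinite_B m

theorem timeB_strictMono (h : IsThresholdRun a b' c₀ s c k) : StrictMono (timeB s) :=
  Nat.nth_strictMono h.infinite_B

theorem eq_A_of_lt_timeB_zero {n : ℕ} (hn : n < timeB s 0) : s n = Party.A := by
  cases hs : s n with
  | A => rfl
  | B =>
    have h1 := Nat.nth_count (p := fun n => s n = Party.B) hs
    have h2 : timeB s 0 ≤ n := by
      rw [timeB, Nat.nth_zero]
      exact Nat.sInf_le hs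
    omega

theorem eq_A_of_lt_timeB_succ {m n : ℕ} (hn : timeB s m < n) (hn' : n < timeB s (m + 1)) :
    s n = Party.A := by
  cases hs : s n with
  | A => rfl
  | B => exact absurd (Nat.le_nth_of_lt_nth_succ hn' hs) (not_le.2 hn)

theorem k_timeB_zero (h : IsThresholdRun a b' c₀ s c k) : k (timeB s 0) = timeB s 0 := by
  have h1 := (h.add_of_forall_A (n := 0) (j := timeB s 0)
    fun i _ hi => eq_A_of_lt_timeB_zero (by simpa using hi)).2
  simpa [h.k_zero] using h1

theorem timeB_succ (h : IsThresholdRun a b' c₀ s c k) (m : ℕ) :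
    timeB s m + 1 + k (timeB s (m + 1)) = timeB s (m + 1) ∧
      c (timeB s (m + 1)) = a * (1 - k (timeB s m) + c (timeB s m)) + b' := by
  have hlt : timeB s m < timeB s (m + 1) := h.timeB_strictMono (Nat.lt_succ_self m)
  obtain ⟨j, hj⟩ := Nat.exists_eq_add_of_le (Nat.succ_le_of_lt hlt)
  obtain ⟨-, h1, h2⟩ := h.of_B _ (h.apply_timeB m)
  obtain ⟨h3, h4⟩ := h.add_of_forall_A (n := timeB s m + 1) (j := j)
    fun i hi hi' => eq_A_of_lt_timeB_succ (m := m) (by omega) (by omega)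
  rw [Nat.succ_eq_add_one] at hj
  rw [hj, h4, h3, h1, h2]
  exact ⟨by ring, rfl⟩

/-- The integer parts of the orbit of the lift associated with a seat sequence. -/
noncomputable def orbitFloor (b' : ℝ) (s : ℕ → Party) (m : ℕ) : ℤ :=
  (timeB s m : ℤ) - m - (m + 1) * (1 + ⌊b'⌋)

/-- The orbit of the lift associated with a seat sequence. -/
noncomputable def orbit (b' : ℝ) (s : ℕ → Party) (c : ℕ → ℝ) (k : ℕ → ℕ) (m : ℕ) : ℝ :=
  orbitFloor b' s m + (1 - k (timeB s m) + c (timeB s m))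

/-- The increments of `orbitFloor` are `k (timeB s (m + 1)) - 1 - ⌊b'⌋`. They absorb the integer
part of `b'` and the seats of `A`, leaving `X (m + 1) = N m + a * (X m - N m) + Int.fract b'`. -/
theorem isOrbit (h : IsThresholdRun a b' c₀ s c k) :
    ContractedRotation.IsOrbit a (Int.fract b') (orbit b' s c k) (orbitFloor b' s) := by
  refine ⟨fun m => ?_, fun m => ?_, fun m => ?_⟩
  · have := h.k_le (timeB s m)
    unfold orbit
    linarith
  · have := (h.of_B _ (h.apply_timeB m)).1
    unfold orbit
    linarith
  · obtain ⟨h1, h2⟩ := h.timeB_succ m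
    have h3 : (timeB s m : ℝ) + 1 + k (timeB s (m + 1)) = timeB s (m + 1) := by exact_mod_cast h1
    unfold orbit orbitFloor
    rw [h2, Int.fract]
    push_cast
    rw [← h3]
    ring

theorem abs_timeB_sub_le (h : IsThresholdRun a b' c₀ s c k) (ha : 0 < a) (ha1 : a ≤ 1)
    (hb' : 0 ≤ b') (hc₀ : 0 ≤ c₀) {ρ : ℝ}
    (hρ : ρ = (ContractedRotation.circleMinus a (Int.fract b') ha ha1).translationNumber) (m : ℕ) :
    |(timeB s m : ℝ) - m * (2 + ⌊b'⌋ + ρ)| ≤ c₀ + a + b' + 4 + ⌊b'⌋ := by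
  have h0 := abs_le.1 (h.isOrbit.abs_sub_le ha ha1 m)
  rw [← hρ] at h0
  have h1 := h.isOrbit.le m
  have h2 := h.isOrbit.le_add_one m
  have h3 := h.isOrbit.le 0
  have h4 := h.isOrbit.le_add_one 0
  have h5 : (timeB s 0 : ℝ) ≤ c₀ + a + b' + 1 := by
    have h6 := h.k_le (timeB s 0)
    rw [h.k_timeB_zero] at h6
    linarith [h.c_le ha.le hb' hc₀ (timeB s 0)]
  have h7 : (0 : ℝ) ≤ timeB s 0 := Nat.cast_nonneg _
  have h8 : (0 : ℝ) ≤ ⌊b'⌋ := by exact_mod_cast Int.floor_nonneg.2 hb'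
  simp only [orbitFloor] at h1 h2 h3 h4
  push_cast at h1 h2 h3 h4
  rw [abs_le]
  constructor <;> linarith

theorem abs_seats_B_sub_le (h : IsThresholdRun a b' c₀ s c k) {lam D : ℝ} (hlam : 0 < lam)
    (hT : ∀ m, |(timeB s m : ℝ) - m * lam| ≤ D) (n : ℕ) :
    |(seats s Party.B n : ℝ) - 1 / lam * n| ≤ (lam + D) / lam := by
  have hD : 0 ≤ D := (abs_nonneg _).trans (hT 0)
  have hle : n ≤ timeB s (seats s Party.B n) := by
    rw [seats_eq_count]
    exact Nat.le_nth_count h.infinite_B n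
  have hle' : (n : ℝ) ≤ timeB s (seats s Party.B n) := by exact_mod_cast hle
  have h1 := abs_le.1 (hT (seats s Party.B n))
  -- If `m + 1` is the count, then `timeB s m < n ≤ timeB s (m + 1)`; the term `lam` pays for this
  -- index shift, and a zero count is trivial.
  have h2 : (seats s Party.B n : ℝ) * lam - lam - D ≤ n := by
    rcases hm : seats s Party.B n with - | m
    · push_cast
      have : (0 : ℝ) ≤ n := Nat.cast_nonneg _
      linarith
    · have h3 : timeB s m < n := by
        refine Nat.nth_lt_of_lt_count ?_
        rw [← seats_eq_count, hm]
        exact Nat.lt_succ_self m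
      have h4 : (timeB s m : ℝ) < n := by exact_mod_cast h3
      have h5 := abs_le.1 (hT m)
      push_cast
      linarith
  have h6 : (seats s Party.B n : ℝ) - 1 / lam * n = (seats s Party.B n * lam - n) / lam := by
    field_simp
  rw [h6, abs_div, abs_of_pos hlam]
  refine div_le_div_of_nonneg_right ?_ hlam.le
  rw [abs_le]
  constructor <;> linarith

theorem eventuallyPeriodic (h : IsThresholdRun a b' c₀ s c k) {q M : ℕ} {p : ℤ} (hq : 0 < q)
    (hp : ∀ m, M ≤ m → orbitFloor b' s (m + q) = orbitFloor b' s m + p) :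
    EventuallyPeriodic s := by
  have hmono := h.timeB_strictMono
  -- The period is read off at `M`: the time difference is `p + q * (2 + ⌊b'⌋)`, the same for all `m
  -- ≥ M`.
  obtain ⟨P, hP⟩ := Nat.exists_eq_add_of_lt (hmono (show M < M + q by omega))
  have hT : ∀ m, M ≤ m → timeB s (m + q) = timeB s m + (P + 1) := by
    intro m hm
    have h1 := hp m hm
    have h2 := hp M le_rfl
    simp only [orbitFloor] at h1 h2
    have h3 : ((timeB s (m + q) : ℕ) : ℤ) = timeB s m + (P + 1) := by
      have h4 : (timeB s (M + q) : ℤ) = timeB s M + P + 1 := by exact_mod_cast hP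
      push_cast at h1 h2
      linarith
    exact_mod_cast h3
  have hex : ∀ n, s n = Party.B → ∃ m, timeB s m = n := fun n hn => ⟨_, Nat.nth_count hn⟩
  refine ⟨timeB s M, P + 1, by omega, fun n hn => ?_⟩
  have hiff : s (n + (P + 1)) = Party.B ↔ s n = Party.B := by
    constructor
    · intro hB
      obtain ⟨m, hm⟩ := hex _ hB
      have hle : M + q ≤ m := hmono.le_iff_le.1 (by rw [hm, hT M le_rfl]; omega)
      obtain ⟨j, rfl⟩ := Nat.exists_eq_add_of_le hle
      have h1 := hT (M + j) (by omega)
      rw [show M + j + q = M + q + j by ring, hm] at h1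
      rw [show n = timeB s (M + j) by omega]
      exact h.apply_timeB _
    · intro hB
      obtain ⟨m, rfl⟩ := hex _ hB
      rw [← hT m (hmono.le_iff_le.1 hn)]
      exact h.apply_timeB _
  cases h1 : s n <;> cases h2 : s (n + (P + 1)) <;> simp_all

end IsThresholdRun

/-! ### Seat shares and the theorem -/

/-- The numbers of seats of the two parties deviate boundedly from `pA * n` and `pB * n`. -/
def HasShares (α β pA pB : ℝ) : Prop :=
  ∃ C : ℝ, ∀ (s : ℕ → Party) (p q : ℕ → ℝ), IsCoordinateRun α β s p q → ∀ n : ℕ,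
    |(seats s Party.A n : ℝ) - pA * n| ≤ C ∧ |(seats s Party.B n : ℝ) - pB * n| ≤ C

theorem abs_seats_A_sub_eq (s : ℕ → Party) (p : ℝ) (n : ℕ) :
    |(seats s Party.A n : ℝ) - (1 - p) * n| = |(seats s Party.B n : ℝ) - p * n| := by
  have h : (seats s Party.A n : ℝ) + seats s Party.B n = n := by
    exact_mod_cast seats_A_add_seats_B s n
  rw [← abs_neg ((seats s Party.B n : ℝ) - p * n)]
  congr 1
  linarith

theorem tendsto_div_of_abs_sub_le {u : ℕ → ℕ} {p C : ℝ} (h : ∀ n, |(u n : ℝ) - p * n| ≤ C) :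
    Tendsto (fun n : ℕ => (u n : ℝ) / n) atTop (𝓝 p) := by
  rw [tendsto_iff_norm_sub_tendsto_zero]
  have h1 : Tendsto (fun n : ℕ => C / (n : ℝ)) atTop (𝓝 0) :=
    tendsto_const_nhds.div_atTop tendsto_natCast_atTop_atTop
  refine tendsto_of_tendsto_of_tendsto_of_le_of_le' tendsto_const_nhds h1
    (Eventually.of_forall fun n => norm_nonneg _) ?_
  filter_upwards [eventually_gt_atTop 0] with n hn
  have hn' : (0 : ℝ) < n := by exact_mod_cast hn
  have h2 : (u n : ℝ) / n - p = (u n - p * n) / n := by field_simp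
  rw [h2, Real.norm_eq_abs, abs_div, abs_of_pos hn']
  exact div_le_div_of_nonneg_right (h n) hn'.le

theorem exists_hasShares_of_pos {α β : ℝ} (hβ : 0 < β) (hβα : β ≤ α) (hαβ : α + β ≤ 1) :
    ∃ ρ : ℝ, ContractedRotation.IsRotationNumber (parA α β) (Int.fract (parB' α β)) ρ ∧
      HasShares α β (1 - 1 / (2 + (⌊parB' α β⌋ : ℝ) + ρ)) (1 / (2 + (⌊parB' α β⌋ : ℝ) + ρ)) ∧
      ((∃ q : ℚ, (q : ℝ) = ρ) → 0 < 1 - α - β → ∀ s : ℕ → Party,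
        IsSeatSequence (twoPartyVotes α β) s → EventuallyPeriodic s) := by
  have ha := parA_pos hβ hβα hαβ
  have ha1 := parA_le_one hβ hβα hαβ
  have hb' := parB'_nonneg hβ hβα hαβ
  have hc₀ : 0 ≤ (α - β) / β := div_nonneg (sub_nonneg.2 hβα) hβ.le
  refine ⟨_, ContractedRotation.isRotationNumber_translationNumber ha ha1, ?_, ?_⟩
  · have hρ := ContractedRotation.translationNumber_circleMinus_nonneg ha ha1
      (Int.fract_nonneg (parB' α β))
    have hfl : (0 : ℝ) ≤ ⌊parB' α β⌋ := by exact_mod_cast Int.floor_nonneg.2 hb'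
    set ρ := (ContractedRotation.circleMinus _ (Int.fract (parB' α β)) ha ha1).translationNumber
      with hρ_def
    set lam := 2 + (⌊parB' α β⌋ : ℝ) + ρ with hlam
    refine ⟨(lam + ((α - β) / β + parA α β + parB' α β + 4 + ⌊parB' α β⌋)) / lam,
      fun s p q hpq n => ?_⟩
    have h := hpq.isThresholdRun hβ hβα hαβ
    rw [abs_seats_A_sub_eq, and_self]
    exact h.abs_seats_B_sub_le (by linarith) (h.abs_timeB_sub_le ha ha1 hb' hc₀ hρ_def) n
  · rintro ⟨r, hr⟩ hγ s hs
    obtain ⟨_, _, hpq⟩ := hs.exists_isCoordinateRun (hβ.le.trans hβα) hβ.le hαβ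
    have h := hpq.isThresholdRun hβ hβα hαβ
    obtain ⟨q, hq, p, M, hp⟩ := h.isOrbit.exists_eventually_add_eq ha
      ((parA_lt_one_iff hβ hβα hαβ).2 hγ) hr
    exact h.eventuallyPeriodic hq hp

/-- A party that is never named alone gets no seat, if the other party is sometimes named alone. -/
theorem IsCoordinateRun.eq_A {α : ℝ} (hα : 0 < α) (hα1 : α ≤ 1) {s : ℕ → Party} {p q : ℕ → ℝ}
    (h : IsCoordinateRun α 0 s p q) (n : ℕ) : s n = Party.A := by
  have step : ∀ n, p n = 0 → s n = Party.A := by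
    intro n hp
    cases hs : s n with
    | A => rfl
    | B =>
      obtain ⟨h1, -, -, h2⟩ := h.of_B n hs
      have h3 := h2 zero_ne_one
      have h4 : 0 < 1 - α := sub_pos.2 (lt_of_le_of_ne hα1 h1)
      rw [hp, div_le_div_iff₀ h4 (by norm_num)] at h3
      linarith
  have hp : p n = 0 := by
    induction n with
    | zero => exact h.p_zero
    | succ n ih => exact (h.of_A n (step n ih)).2.1
  exact step n hp

theorem hasShares_of_eq_zero {α : ℝ} (hα : 0 < α) (hα1 : α ≤ 1) : HasShares α 0 1 0 := by
  refine ⟨0, fun s p q h n => ?_⟩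
  have hB : seats s Party.B n = 0 := by
    rw [seats_eq_count, Nat.count_iff_forall_not]
    intro m _
    simp [h.eq_A hα hα1 m]
  have hA := abs_seats_A_sub_eq s 0 n
  rw [sub_zero] at hA
  rw [hA, hB]
  simp

/-- Coordinate runs are visibly symmetric in the parties, which is why `HasShares` is phrased with
them; this covers `α < β`. -/
theorem HasShares.swap {α β pA pB : ℝ} (h : HasShares α β pA pB) : HasShares β α pB pA := by
  obtain ⟨C, hC⟩ := h
  refine ⟨C, fun s p q hs n => ?_⟩
  have h1 := hC _ _ _ hs.swap n
  have hA : seats (fun n => (s n).swap) Party.A n = seats s Party.B n := by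
    simp only [seats, Party.swap_eq_A]
  have hB : seats (fun n => (s n).swap) Party.B n = seats s Party.A n := by
    simp only [seats, Party.swap_eq_B]
  rw [hA, hB] at h1
  exact h1.symm

theorem exists_hasShares {α β : ℝ} (hβ : 0 ≤ β) (hβα : β ≤ α) (hαβ : α + β ≤ 1)
    (hpos : 0 < α + β) : ∃ pA pB, pB = 1 - pA ∧ HasShares α β pA pB := by
  rcases hβ.eq_or_lt with rfl | hβ
  · exact ⟨1, 0, by norm_num, hasShares_of_eq_zero (by linarith) (by linarith)⟩
  · obtain ⟨ρ, -, h, -⟩ := exists_hasShares_of_pos hβ hβα hαβ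
    exact ⟨_, _, by ring, h⟩

theorem HasShares.bound_and_tendsto {α β pA pB : ℝ} (hα : 0 ≤ α) (hβ : 0 ≤ β) (hαβ : α + β ≤ 1)
    (h : HasShares α β pA pB) :
    (∀ s : ℕ → Party, IsSeatSequence (twoPartyVotes α β) s →
      Tendsto (fun n : ℕ => (seats s Party.A n : ℝ) / (n : ℝ)) atTop (𝓝 pA) ∧
      Tendsto (fun n : ℕ => (seats s Party.B n : ℝ) / (n : ℝ)) atTop (𝓝 pB)) ∧
    ∃ C : ℝ, ∀ s : ℕ → Party, IsSeatSequence (twoPartyVotes α β) s → ∀ n : ℕ,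
      |(seats s Party.A n : ℝ) - pA * n| ≤ C ∧ |(seats s Party.B n : ℝ) - pB * n| ≤ C := by
  obtain ⟨C, hC⟩ := h
  have hbound : ∀ s : ℕ → Party, IsSeatSequence (twoPartyVotes α β) s → ∀ n : ℕ,
      |(seats s Party.A n : ℝ) - pA * n| ≤ C ∧ |(seats s Party.B n : ℝ) - pB * n| ≤ C := by
    intro s hs
    obtain ⟨p, q, hpq⟩ := hs.exists_isCoordinateRun hα hβ hαβ
    exact hC s p q hpq
  exact ⟨fun s hs => ⟨tendsto_div_of_abs_sub_le fun n => (hbound s hs n).1,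
    tendsto_div_of_abs_sub_le fun n => (hbound s hs n).2⟩, C, hbound⟩

end Phragmen

theorem theorem1p1 (α β : ℝ) (hα : 0 ≤ α) (hβ : 0 ≤ β) (hαβ : α + β ≤ 1) (hpos : 0 < α + β) :
    ∃ pA pB : ℝ, pB = 1 - pA ∧
      -- convergence of the fractions of seats
      (∀ s : ℕ → Phragmen.Party,
        Phragmen.IsSeatSequence (Phragmen.twoPartyVotes α β) s →
          Tendsto (fun n : ℕ => (Phragmen.seats s Phragmen.Party.A n : ℝ) / (n : ℝ)) atTop (𝓝 pA) ∧
          Tendsto (fun n : ℕ => (Phragmen.seats s Phragmen.Party.B n : ℝ) / (n : ℝ)) atTop (𝓝 pB)) ∧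
      -- (i)
      (∃ C : ℝ, ∀ s : ℕ → Phragmen.Party,
        Phragmen.IsSeatSequence (Phragmen.twoPartyVotes α β) s → ∀ n : ℕ,
          |(Phragmen.seats s Phragmen.Party.A n : ℝ) - pA * n| ≤ C ∧
          |(Phragmen.seats s Phragmen.Party.B n : ℝ) - pB * n| ≤ C) ∧
      -- (ii) and (iii)
      (β ≤ α → 0 < β →
        0 < Phragmen.parA α β ∧ Phragmen.parA α β ≤ 1 ∧
        (Phragmen.parA α β < 1 ↔ 0 < 1 - α - β) ∧
        ∃ ρ : ℝ,
          ContractedRotation.IsRotationNumber (Phragmen.parA α β)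
            (Int.fract (Phragmen.parB' α β)) ρ ∧
          pB = 1 / (2 + (⌊Phragmen.parB' α β⌋ : ℝ) + ρ) ∧
          ((∃ q : ℚ, (q : ℝ) = ρ) → 0 < 1 - α - β →
            ∀ s : ℕ → Phragmen.Party,
              Phragmen.IsSeatSequence (Phragmen.twoPartyVotes α β) s →
                Phragmen.EventuallyPeriodic s)) := by
  by_cases h : β ≤ α ∧ 0 < β
  · obtain ⟨h1, h2⟩ := h
    obtain ⟨ρ, hρ, hs, hper⟩ := Phragmen.exists_hasShares_of_pos h2 h1 hαβ
    obtain ⟨ht, hb⟩ := hs.bound_and_tendsto hα hβ hαβ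
    exact ⟨_, _, by ring, ht, hb, fun _ _ => ⟨Phragmen.parA_pos h2 h1 hαβ,
      Phragmen.parA_le_one h2 h1 hαβ, Phragmen.parA_lt_one_iff h2 h1 hαβ, ρ, hρ, rfl, hper⟩⟩
  -- Here `α < β` or `β = 0`, so the explicit formula and the periodicity claim are vacuous.
  · obtain ⟨pA, pB, hp, hs⟩ : ∃ pA pB, pB = 1 - pA ∧ Phragmen.HasShares α β pA pB := by
      rcases le_total β α with h1 | h1
      · exact Phragmen.exists_hasShares hβ h1 hαβ hpos
      · obtain ⟨pB, pA, hp, hs⟩ := Phragmen.exists_hasShares hα h1 (by linarith) (by linarith)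
        exact ⟨pA, pB, by linarith, hs.swap⟩
    obtain ⟨ht, hb⟩ := hs.bound_and_tendsto hα hβ hαβ
    exact ⟨pA, pB, hp, ht, hb, fun h1 h2 => absurd ⟨h1, h2⟩ h⟩
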